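/- Let $R$ be an associative ring with identity. For $R$-modules $M, N$ on the same side, $M$ is $N$-injective if every homomorphism from a submodule of $N$ to $M$ extends to $N$, and $M$ is $N$-projective if for every epimorphism $g : N \to K$ every homomorphism $\psi : M \to K$ factors as $\psi = g\chi$ with $\chi : M \to N$. Put $$\mathfrak{In}^{-1}(M) = \{N : M \text{ is } N\text{-injective}\}, \qquad \mathfrak{Pr}^{-1}(M) = \{N : M \text{ is } N\text{-projective}\}.$$ Let $i\mathcal{P}_r(R)$ be the collection of all classes $\mathfrak{In}^{-1}(M)$ with $M$ a right $R$-module, and let $p\mathcal{P}_r(R)$ (resp. $p\mathcal{P}_\ell(R)$) be the collection of all classes $\mathfrak{Pr}^{-1}(M)$ with $M$ a right (resp. left) $R$-module; each is ordered by inclusion. A module is quasi-injective (quasi-projective) if it is injective (projective) relative to itself. $R$ has no right $i$-middle class if every right $R$-module $M$ is injective or poor, where poor means that $\mathfrak{In}^{-1}(M)$ consists precisely of the semisimple modules. $R$ has no right (left) $p$-middle class if every right (left) $R$-module $M$ is projective or $p$-poor, where $p$-poor means that $\mathfrak{Pr}^{-1}(M)$ contains only semisimple modules. Let $R$ be right artinian.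 Then $i\mathcal{P}_r(R)$, $p\mathcal{P}_r(R)$ and $p\mathcal{P}_\ell(R)$ are lattices, and they are all isomorphic. Moreover, the following conditions are equivalent. 1. $R$ has no right $i$-middle class. 2. Every non-semisimple quasi-injective right $R$-module is injective. 3. $R$ has no right $p$-middle class. 4. Every non-semisimple quasi-projective right $R$-module is projective. 5. $R$ has no left $p$-middle class. 6. Every non-semisimple quasi-projective left $R$-module is projective. -/

import Mathlib

universe u

/-! Modules over a ring `S` are left `S`-modules, as in Mathlib. Right modules over a ring `R`
are left modules over the opposite ring `Rᵐᵒᵖ`. -/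

/-- `M` is `N`-injective: every morphism from a submodule of `N` to `M` extends to `N`. -/
def RelInjective (S : Type u) [Ring S] (M N : Type u) [AddCommGroup M] [Module S M]
    [AddCommGroup N] [Module S N] : Prop :=
  ∀ (K : Submodule S N) (φ : K →ₗ[S] M), ∃ ψ : N →ₗ[S] M, ∀ x : K, ψ x = φ x

/-- `M` is `N`-projective: every morphism from `M` to a module `K` lifts along every
epimorphism from `N` onto `K`. -/
def RelProjective (S : Type u) [Ring S] (M N : Type u) [AddCommGroup M] [Module S M]
    [AddCommGroup N] [Module S N] : Prop :=
  ∀ (K : Type u) [AddCommGroup K] [Module S K] (g : N →ₗ[S] K), Function.Surjective g →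
    ∀ ψ : M →ₗ[S] K, ∃ χ : M →ₗ[S] N, g ∘ₗ χ = ψ

/-- The injectivity domain of `M`, a class of modules. -/
def injectivityDomain (S : Type u) [Ring S] (M : ModuleCat.{u} S) : Set (ModuleCat.{u} S) :=
  {N | RelInjective S M N}

/-- The projectivity domain of `M`, a class of modules. -/
def projectivityDomain (S : Type u) [Ring S] (M : ModuleCat.{u} S) : Set (ModuleCat.{u} S) :=
  {N | RelProjective S M N}

/-- The `i`-profile of `S`: the collection of the injectivity domains of all (left) `S`-modules.
It is ordered by inclusion. -/
def iProfile (S : Type u) [Ring S] : Set (Set (ModuleCat.{u} S)) :=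
  {A | ∃ M : ModuleCat.{u} S, A = injectivityDomain S M}

/-- The `p`-profile of `S`: the collection of the projectivity domains of all (left) `S`-modules.
It is ordered by inclusion. -/
def pProfile (S : Type u) [Ring S] : Set (Set (ModuleCat.{u} S)) :=
  {A | ∃ M : ModuleCat.{u} S, A = projectivityDomain S M}

/-- `M` is poor: its injectivity domain consists precisely of the semisimple modules. -/
def IsPoorModule (S : Type u) [Ring S] (M : ModuleCat.{u} S) : Prop :=
  injectivityDomain S M = {N : ModuleCat.{u} S | IsSemisimpleModule S N}

/-- `M` is `p`-poor: its projectivity domain contains only semisimple modules. -/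
def IsPPoorModule (S : Type u) [Ring S] (M : ModuleCat.{u} S) : Prop :=
  projectivityDomain S M ⊆ {N : ModuleCat.{u} S | IsSemisimpleModule S N}

/-- `S` has no `i`-middle class: every module is injective or poor. -/
def HasNoIMiddleClass (S : Type u) [Ring S] : Prop :=
  ∀ M : ModuleCat.{u} S, Module.Injective S M ∨ IsPoorModule S M

/-- `S` has no `p`-middle class: every module is projective or `p`-poor. -/
def HasNoPMiddleClass (S : Type u) [Ring S] : Prop :=
  ∀ M : ModuleCat.{u} S, Module.Projective S M ∨ IsPPoorModule S M

/-- Every non-semisimple quasi-injective (that is, self-injective) module is injective. -/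
def QuasiInjectiveImpInjective (S : Type u) [Ring S] : Prop :=
  ∀ M : ModuleCat.{u} S, ¬ IsSemisimpleModule S M → RelInjective S M M → Module.Injective S M

/-- Every non-semisimple quasi-projective (that is, projective relative to itself) module is
projective. -/
def QuasiProjectiveImpProjective (S : Type u) [Ring S] : Prop :=
  ∀ M : ModuleCat.{u} S, ¬ IsSemisimpleModule S M → RelProjective S M M → Module.Projective S M

/-- A partially ordered collection is a lattice: any two elements have a supremum and an
infimum. -/
def IsLatticeOrder (α : Type*) [PartialOrder α] : Prop :=
  ∀ a b : α, (∃ c, IsLUB {a, b} c) ∧ (∃ c, IsGLB {a, b} c)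

/-!
# Profiles of a one-sided artinian ring

For a module `M` over a one-sided artinian ring `S` with Jacobson radical `J`, the injectivity
domain of `M` (for modules on the artinian side) and the projectivity domain of `M` (on either side)
are both of the form `annihilatedBy S I`, the class of modules annihilated by `I`, for a two-sided
ideal `I ≤ J`, and every such ideal occurs. So each profile is anti-isomorphic to the lattice of
two-sided ideals contained in `J`, which is the same lattice for `R` and for its opposite ring.
Furthermore `M` is injective (projective) exactly when `I = ⊥`, and poor (`p`-poor) exactly when
`I = J`. Hence each of the six conditions says that there is no two-sided ideal strictly between
`⊥` and `J`; for the conditions on quasi-injective and quasi-projective modules the point is that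
`annihilatedBy S I` is the domain of a module that belongs to it and is not semisimple unless
`I = J`.

* Injectivity. The left ideals `L` for which `M` is `S ⧸ L`-injective are closed under
  intersections, so there is a least one by the chain condition. It is two-sided, and a Baer-type
  extension argument (`RelInjective.of_iSup_eq_top`) shows that it determines the domain. The ideal
  `I` is realized by the elements annihilated by `I` in an injective module containing all simple
  modules.
* Projectivity. `S` being semiprimary, `M` has a projective cover `P → M`, with kernel `K` say, and
  `M` is `N`-projective exactly when all morphisms `P → N` vanish on `K`
  (`relProjective_iff_of_projective_cover`). This happens exactly when `N` is annihilated by the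
  trace ideal generated by the values on `K` of the morphisms `P → S`. The ideal `I` is realized by
  `S ⧸ I`, whose projective cover is `S`.

The radical enters only as a nilpotent ideal with semisimple quotient ring, `IsNilpotentRadical`,
a notion which passes to the opposite ring.
-/

/-! ### Classes of modules annihilated by an ideal -/

section Annihilated

variable (S : Type u) [Ring S]

/-- The class of modules annihilated by the two-sided ideal `I`, that is, the class of modules over
the quotient of `S` by `I`. -/
def annihilatedBy (I : TwoSidedIdeal S) : Set (ModuleCat.{u} S) :=
  {N | ∀ a ∈ I, ∀ x : N, a • x = 0}

variable {S}

theorem mem_annihilatedBy_quotient_iff {I I' : TwoSidedIdeal S} :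
    ModuleCat.of S (S ⧸ I.asIdeal) ∈ annihilatedBy S I' ↔ I' ≤ I := by
  constructor
  · intro h a ha
    have h1 : a • (Submodule.Quotient.mk (1 : S) : S ⧸ I.asIdeal) = 0 := h a ha _
    rw [← Submodule.Quotient.mk_smul, Submodule.Quotient.mk_eq_zero] at h1
    simpa using h1
  · intro h a ha x
    obtain ⟨y, rfl⟩ := Submodule.Quotient.mk_surjective _ (show S ⧸ I.asIdeal from x)
    change Submodule.Quotient.mk (a • y) = _
    rw [Submodule.Quotient.mk_eq_zero]
    exact TwoSidedIdeal.mul_mem_right _ _ _ (h ha)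

theorem annihilatedBy_subset_iff {I I' : TwoSidedIdeal S} :
    annihilatedBy S I ⊆ annihilatedBy S I' ↔ I' ≤ I :=
  ⟨fun h ↦ mem_annihilatedBy_quotient_iff.1 (h (mem_annihilatedBy_quotient_iff.2 le_rfl)),
    fun h _ hN a ha ↦ hN a (h ha)⟩

theorem annihilatedBy_eq_univ_iff {I : TwoSidedIdeal S} :
    annihilatedBy S I = Set.univ ↔ I = ⊥ := by
  have : annihilatedBy S ⊥ = Set.univ := Set.eq_univ_of_forall fun N a ha x ↦ by
    rw [(TwoSidedIdeal.mem_bot _).1 ha, zero_smul]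
  rw [← Set.univ_subset_iff, ← this, annihilatedBy_subset_iff, le_bot_iff]

end Annihilated

/-! ### The radical of a semiprimary ring -/

section Radical

variable {S : Type u} [Ring S]

/-- `J` is nilpotent with semisimple quotient ring. Such an ideal is the Jacobson radical, and it
exists exactly when the ring is semiprimary; unlike the definition of the Jacobson radical, this
description is visibly left-right symmetric. -/
structure IsNilpotentRadical (J : TwoSidedIdeal S) : Prop where
  isNilpotent : IsNilpotent J.asIdeal
  isSemisimpleRing : IsSemisimpleRing (S ⧸ J.asIdeal)

theorem IsNilpotentRadical.of_isArtinianRing [IsArtinianRing S] :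
    IsNilpotentRadical (Ring.jacobson S).toTwoSided where
  isNilpotent := by simpa using IsSemiprimaryRing.isNilpotent
  isSemisimpleRing := by
    have : IsSemisimpleRing (S ⧸ Ring.jacobson S) := inferInstance
    convert this <;> simp

theorem IsNilpotentRadical.unop {J : TwoSidedIdeal Sᵐᵒᵖ} (hJ : IsNilpotentRadical J) :
    IsNilpotentRadical J.unop where
  isNilpotent := by
    obtain ⟨n, hn⟩ := hJ.isNilpotent
    have key : ∀ k, ∀ x ∈ J.unop.asIdeal ^ k, MulOpposite.op x ∈ J.asIdeal ^ k := by
      intro k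
      induction k with
      | zero =>
        intro x _
        rw [Submodule.pow_zero, Ideal.one_eq_top]
        trivial
      | succ k ih =>
        intro x hx
        rw [Ideal.IsTwoSided.pow_succ] at hx
        refine Submodule.smul_induction_on hx (fun a ha b hb ↦ ?_) (fun a b ha hb ↦ ?_)
        · rw [smul_eq_mul, MulOpposite.op_mul, Submodule.pow_succ]
          exact Ideal.mul_mem_mul (ih b hb) (by simpa using ha)
        · rw [MulOpposite.op_add]
          exact add_mem ha hb
    refine ⟨n, ?_⟩
    rw [Ideal.zero_eq_bot, eq_bot_iff]
    intro x hx
    have := key n x hx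
    rw [hn] at this
    simpa using this
  isSemisimpleRing := by
    have := hJ.isSemisimpleRing
    let g : Sᵐᵒᵖ →+* (S ⧸ J.unop.asIdeal)ᵐᵒᵖ := (Ideal.Quotient.mk _).op
    have hg : ∀ a ∈ J.asIdeal, g a = 0 := fun a ha ↦ MulOpposite.unop_injective <|
      Ideal.Quotient.eq_zero_iff_mem.2 (by simpa using ha)
    have hs : Function.Surjective (Ideal.Quotient.lift J.asIdeal g hg) := by
      refine Ideal.Quotient.lift_surjective_of_surjective _ _ fun x ↦ ?_
      obtain ⟨y, hy⟩ := Ideal.Quotient.mk_surjective x.unop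
      exact ⟨MulOpposite.op y, MulOpposite.unop_injective hy⟩
    exact isSemisimpleRing_mulOpposite_iff.1 (RingHom.isSemisimpleRing_of_surjective _ hs)

/-- Nakayama's lemma for a nilpotent ideal; the module need not be finitely generated. -/
theorem Submodule.eq_top_of_smul_sup_eq_top {M : Type u} [AddCommGroup M] [Module S M]
    {I : Ideal S} (hI : IsNilpotent I) {L : Submodule S M} (h : I • ⊤ ⊔ L = ⊤) : L = ⊤ := by
  have key : ∀ k : ℕ, (I ^ k) • (⊤ : Submodule S M) ⊔ L = ⊤ := by
    intro k
    induction k with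
    | zero => rw [Submodule.pow_zero, Ideal.one_eq_top, Submodule.top_smul, top_sup_eq]
    | succ k ih =>
      rw [Submodule.pow_succ, Submodule.mul_smul, eq_top_iff]
      nth_rw 1 [← ih]
      nth_rw 1 [← h]
      rw [Submodule.smul_sup, sup_assoc]
      exact sup_le_sup le_rfl (sup_le Submodule.smul_le_right le_rfl)
  obtain ⟨n, hn⟩ := hI
  simpa [hn] using key n

theorem IsNilpotentRadical.isSemisimpleModule_iff {J : TwoSidedIdeal S}
    (hJ : IsNilpotentRadical J) (N : ModuleCat.{u} S) :
    IsSemisimpleModule S N ↔ N ∈ annihilatedBy S J := by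
  constructor
  · intro hN
    obtain ⟨C, hC⟩ := exists_isCompl (J.asIdeal • (⊤ : Submodule S N))
    have hC' := Submodule.eq_top_of_smul_sup_eq_top hJ.isNilpotent hC.sup_eq_top
    subst hC'
    have h0 : J.asIdeal • (⊤ : Submodule S N) = ⊥ := by simpa using hC.inf_eq_bot
    intro a ha x
    rw [← Submodule.mem_bot S, ← h0]
    exact Submodule.smul_mem_smul (by simpa using ha) trivial
  · intro hN
    have hT : Module.IsTorsionBySet S N J.asIdeal := fun x a ↦ hN a (by simpa using a.2) x
    have := hJ.isSemisimpleRing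
    let _ := hT.module
    exact hT.isSemisimpleModule_iff.1 inferInstance

end Radical

/-! ### Injectivity domains over an artinian ring -/

section Injectivity

variable {S : Type u} [Ring S] {M N N' : Type u} [AddCommGroup M] [Module S M]
  [AddCommGroup N] [Module S N] [AddCommGroup N'] [Module S N']

theorem RelInjective.of_injective (h : RelInjective S M N) (i : N' →ₗ[S] N)
    (hi : Function.Injective i) : RelInjective S M N' := by
  intro K φ
  let e := Submodule.equivMapOfInjective i hi K
  obtain ⟨ψ, hψ⟩ := h (K.map i) (φ ∘ₗ e.symm.toLinearMap)
  refine ⟨ψ ∘ₗ i, fun x ↦ ?_⟩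
  have := hψ (e x)
  simpa [e] using this

theorem RelInjective.of_surjective (h : RelInjective S M N) (p : N →ₗ[S] N')
    (hp : Function.Surjective p) : RelInjective S M N' := by
  intro K φ
  let q : K.comap p →ₗ[S] K := p.restrict fun x hx ↦ hx
  obtain ⟨ψ, hψ⟩ := h (K.comap p) (φ ∘ₗ q)
  have hker : LinearMap.ker p ≤ LinearMap.ker ψ := by
    intro x hx
    rw [LinearMap.mem_ker] at hx ⊢
    have hxK : x ∈ K.comap p := by simp [hx]
    have h0 : q ⟨x, hxK⟩ = 0 := Subtype.ext hx
    have := hψ ⟨x, hxK⟩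
    simpa [h0] using this
  let e := p.quotKerEquivOfSurjective hp
  refine ⟨(LinearMap.ker p).liftQ ψ hker ∘ₗ e.symm.toLinearMap, fun y ↦ ?_⟩
  obtain ⟨x, hx⟩ := hp y
  have hxK : x ∈ K.comap p := by simp [hx]
  have he : e.symm y = Submodule.Quotient.mk x := by
    rw [LinearEquiv.symm_apply_eq]
    exact hx.symm
  have hq : q ⟨x, hxK⟩ = y := Subtype.ext hx
  have := hψ ⟨x, hxK⟩
  simpa [he, hq] using this

theorem RelInjective.of_isSemisimpleModule [IsSemisimpleModule S N] : RelInjective S M N := by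
  intro K φ
  obtain ⟨C, hC⟩ := exists_isCompl K
  exact ⟨φ ∘ₗ K.projectionOnto C hC, fun x ↦ by simp⟩

/-- If `M` is `A`-injective for a submodule `A` of `N`, every partial morphism from `N` to `M`
extends to a partial morphism whose domain contains `A`. -/
theorem RelInjective.exists_le_domain (f : N →ₗ.[S] M) (A : Submodule S N)
    (hA : RelInjective S M A) : ∃ g : N →ₗ.[S] M, f ≤ g ∧ A ≤ g.domain := by
  obtain ⟨ψ, hψ⟩ := hA (f.domain.comap A.subtype)
    (f.toFun ∘ₗ A.subtype.restrict fun x hx ↦ hx)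
  have hc : ∀ (x : f.domain) (y : A), (x : N) = y → f x = ψ y := by
    intro x y hxy
    have hy : y ∈ f.domain.comap A.subtype := by simp [← hxy]
    rw [hψ ⟨y, hy⟩]
    exact congrArg f (Subtype.ext hxy)
  exact ⟨f.sup ⟨A, ψ⟩ hc, f.left_le_sup _ hc, (f.right_le_sup ⟨A, ψ⟩ hc).1⟩

/-- Zorn's lemma: a maximal partial extension is defined on every member of the family. -/
theorem RelInjective.of_iSup_eq_top {ι : Type*} {A : ι → Submodule S N}
    (hA : ∀ i, RelInjective S M (A i)) (htop : ⨆ i, A i = ⊤) : RelInjective S M N := by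
  intro K φ
  obtain ⟨g, hg, hmax⟩ := zorn_le_nonempty_Ici₀ (⟨K, φ⟩ : N →ₗ.[S] M)
    (fun c _ hc y hy ↦ ⟨LinearPMap.sSup c hc.directedOn, fun _ ↦ LinearPMap.le_sSup hc.directedOn⟩)
    _ le_rfl
  have hdom : g.domain = ⊤ := by
    rw [eq_top_iff, ← htop]
    refine iSup_le fun i ↦ ?_
    obtain ⟨g', hgg', hi⟩ := RelInjective.exists_le_domain g (A i) (hA i)
    exact hi.trans (hmax hgg').1
  refine ⟨g.toFun ∘ₗ LinearMap.id.codRestrict g.domain (fun x ↦ hdom ▸ trivial), fun x ↦ ?_⟩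
  exact (hg.2 (x := x) (y := ⟨x, hdom ▸ trivial⟩) rfl).symm

theorem RelInjective.quotient_inf {L L' : Ideal S} (h : RelInjective S M (S ⧸ L))
    (h' : RelInjective S M (S ⧸ L')) : RelInjective S M (S ⧸ L ⊓ L') := by
  have hprod : RelInjective S M ((S ⧸ L) × (S ⧸ L')) := by
    refine RelInjective.of_iSup_eq_top (A := fun b : Bool ↦
      cond b (LinearMap.range (LinearMap.inl S _ _)) (LinearMap.range (LinearMap.inr S _ _))) ?_ ?_
    · rintro (_ | _)
      · exact h'.of_surjective _ (LinearMap.surjective_rangeRestrict _)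
      · exact h.of_surjective _ (LinearMap.surjective_rangeRestrict _)
    · rw [iSup_bool_eq]
      exact LinearMap.sup_range_inl_inr
  refine hprod.of_injective ((L ⊓ L').liftQ (L.mkQ.prod L'.mkQ) ?_) ?_
  · rw [LinearMap.ker_prod]
    simp
  · rw [← LinearMap.ker_eq_bot, Submodule.ker_liftQ_eq_bot]
    rw [LinearMap.ker_prod]
    simp

theorem RelInjective.quotient_ker_toSpanSingleton (h : RelInjective S M N) (x : N) :
    RelInjective S M (S ⧸ LinearMap.ker (LinearMap.toSpanSingleton S N x)) :=
  h.of_injective (Submodule.liftQ _ _ le_rfl)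
    (LinearMap.ker_eq_bot.1 (Submodule.ker_liftQ_eq_bot _ _ _ le_rfl))

/-- Over an artinian ring the left ideals `L` for which `M` is injective relative to `S ⧸ L` have
a least member, since they are closed under intersections. It is two-sided and annihilates exactly
the modules in the injectivity domain of `M`. -/
theorem exists_injectivityDomain_eq_annihilatedBy [IsArtinianRing S] {J : TwoSidedIdeal S}
    (hJ : IsNilpotentRadical J) (M : ModuleCat.{u} S) :
    ∃ I ≤ J, injectivityDomain S M = annihilatedBy S I := by
  have hJM : RelInjective S M (S ⧸ J.asIdeal) := by
    have : IsSemisimpleModule S (ModuleCat.of S (S ⧸ J.asIdeal)) :=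
      (hJ.isSemisimpleModule_iff _).2 (mem_annihilatedBy_quotient_iff.2 le_rfl)
    exact RelInjective.of_isSemisimpleModule (N := ModuleCat.of S (S ⧸ J.asIdeal))
  obtain ⟨L, hL, hmin⟩ := IsArtinian.set_has_minimal
    {L : Ideal S | RelInjective S M (S ⧸ L)} ⟨_, hJM⟩
  have hle : ∀ L' : Ideal S, RelInjective S M (S ⧸ L') → L ≤ L' := by
    intro L' hL'
    by_contra hn
    exact hmin (L ⊓ L') (hL.quotient_inf hL') (inf_lt_left.2 hn)
  have hann : ∀ N : ModuleCat.{u} S, RelInjective S M N → ∀ a ∈ L, ∀ x : N, a • x = 0 :=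
    fun N hN a ha x ↦ hle _ (hN.quotient_ker_toSpanSingleton x) ha
  have : Ideal.IsTwoSided L := ⟨fun {a} b ha ↦ by
    have := hann (ModuleCat.of S (S ⧸ L)) hL a ha (Submodule.Quotient.mk b : S ⧸ L)
    exact (Submodule.Quotient.mk_eq_zero L).1 this⟩
  refine ⟨Ideal.toTwoSided L, fun a ha ↦ ?_, Set.ext fun N ↦ ⟨fun hN a ha ↦ ?_, fun hN ↦ ?_⟩⟩
  · simpa using hle _ hJM (by simpa using ha)
  · exact hann N hN a (by simpa using ha)
  · refine RelInjective.of_iSup_eq_top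
      (A := fun x : N ↦ LinearMap.range (LinearMap.toSpanSingleton S N x)) (fun x ↦ ?_) ?_
    · have hker : L ≤ LinearMap.ker (LinearMap.toSpanSingleton S N x) :=
        fun a ha ↦ hN a (by simpa using ha) x
      refine hL.of_surjective (L.liftQ (LinearMap.toSpanSingleton S N x).rangeRestrict ?_) ?_
      · rwa [LinearMap.ker_rangeRestrict]
      · rw [← LinearMap.range_eq_top, Submodule.range_liftQ, LinearMap.range_eq_top]
        exact LinearMap.surjective_rangeRestrict _
    · rw [eq_top_iff]
      intro x _
      exact Submodule.mem_iSup_of_mem x ⟨1, by simp⟩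

theorem injectivityDomain_eq_univ_iff (M : ModuleCat.{u} S) :
    injectivityDomain S M = Set.univ ↔ Module.Injective S M := by
  constructor
  · intro h
    refine Module.Baer.injective fun I g ↦ ?_
    have hS : ModuleCat.of S S ∈ injectivityDomain S M := h ▸ trivial
    obtain ⟨ψ, hψ⟩ := hS I g
    exact ⟨ψ, fun x hx ↦ hψ ⟨x, hx⟩⟩
  · intro h
    refine Set.eq_univ_of_forall fun N K φ ↦ ?_
    obtain ⟨ψ, hψ⟩ := Module.Injective.extension_property S M K N K.subtype
      K.injective_subtype φ
    exact ⟨ψ, fun x ↦ LinearMap.congr_fun hψ x⟩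

variable (S) in
/-- There is an injective module containing a copy of every simple module. -/
theorem exists_injective_forall_isMaximal :
    ∃ E : ModuleCat.{u} S, Module.Injective S E ∧ ∀ m : Ideal S, m.IsMaximal →
      ∃ j : (S ⧸ m) →ₗ[S] E, Function.Injective j := by
  classical
  let X := ModuleCat.of S (∀ m : {m : Ideal S // m.IsMaximal}, S ⧸ m.1)
  let ι := CategoryTheory.Injective.ι X
  refine ⟨CategoryTheory.Injective.under X, (Module.injective_iff_injective_object S _).2
    (CategoryTheory.Injective.injective_under X),
    fun m hm ↦ ⟨ι.hom ∘ₗ LinearMap.single S (fun m : {m : Ideal S // m.IsMaximal} ↦ S ⧸ m.1)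
      ⟨m, hm⟩, ?_⟩⟩
  exact ((ModuleCat.mono_iff_injective ι).1 inferInstance).comp fun _ _ h ↦
    Pi.single_injective (M := fun m : {m : Ideal S // m.IsMaximal} ↦ S ⧸ m.1) _ h

/-- The submodule of the elements of `E` that are annihilated by the two-sided ideal `I`. -/
def annihilatedElements (I : TwoSidedIdeal S) (E : Type u) [AddCommGroup E] [Module S E] :
    Submodule S E where
  carrier := {x | ∀ a ∈ I, a • x = 0}
  add_mem' hx hy a ha := by rw [smul_add, hx a ha, hy a ha, add_zero]
  zero_mem' a _ := smul_zero a
  smul_mem' b x hx a ha := by rw [← mul_smul, hx _ (I.mul_mem_right _ _ ha)]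

/-- If `E` is injective and contains every simple module, then its largest submodule annihilated
by `I` is an injective cogenerator among the modules annihilated by `I`. -/
theorem exists_injectivityDomain_eq {J : TwoSidedIdeal S} (hJ : IsNilpotentRadical J)
    {I : TwoSidedIdeal S} (hI : I ≤ J) :
    ∃ M : ModuleCat.{u} S, injectivityDomain S M = annihilatedBy S I ∧
      M ∈ annihilatedBy S I ∧ (M ∈ annihilatedBy S J → J ≤ I) := by
  obtain ⟨E, hE, hsimple⟩ := exists_injective_forall_isMaximal S
  let M := annihilatedElements I E
  -- `E` being a cogenerator, what acts as zero on `M` acts as zero on the injectivity domain.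
  have key : ∀ N : ModuleCat.{u} S, RelInjective S M N → ∀ a : S, (∀ y : M, a • y = 0) →
      ∀ x : N, a • x = 0 := by
    intro N hN a ha x
    by_contra hax
    let t := LinearMap.toSpanSingleton S N (a • x)
    have hA : LinearMap.ker t ≠ ⊤ := by
      rw [Ideal.ne_top_iff_one, LinearMap.mem_ker, LinearMap.toSpanSingleton_apply, one_smul]
      exact hax
    obtain ⟨m, hm, hAm⟩ := Ideal.exists_le_maximal _ hA
    obtain ⟨j, hj⟩ := hsimple m hm
    obtain ⟨g, hg⟩ := Module.Injective.extension_property S E _ N ((LinearMap.ker t).liftQ t le_rfl)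
      (LinearMap.ker_eq_bot.1 (Submodule.ker_liftQ_eq_bot _ _ _ le_rfl))
      (j ∘ₗ Submodule.factor hAm)
    have hg' : ∀ s : S, g (s • a • x) = j (Submodule.Quotient.mk s) := fun s ↦
      LinearMap.congr_fun hg (Submodule.Quotient.mk s)
    have hmJ : ∀ b ∈ J, ∀ z : S ⧸ m, b • z = 0 := by
      have : IsSimpleModule S (S ⧸ m) := isSimpleModule_iff_isCoatom.2 hm.out
      exact (hJ.isSemisimpleModule_iff (ModuleCat.of S (S ⧸ m))).1
        (inferInstanceAs (IsSemisimpleModule S (S ⧸ m)))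
    have hmem : ∀ k : LinearMap.range t, (g.domRestrict (LinearMap.range t)) k ∈ M := by
      rintro ⟨_, s, rfl⟩ b hb
      change b • g (s • a • x) = 0
      rw [hg', ← map_smul, hmJ b (hI hb), map_zero]
    obtain ⟨ψ, hψ⟩ := hN (LinearMap.range t) ((g.domRestrict _).codRestrict M hmem)
    have h1 : ψ (a • x) = 0 := by rw [map_smul, ha]
    have h2 := hψ ⟨a • x, 1, by simp [t]⟩
    have h3 : g (a • x) = 0 := by
      simpa [h1] using (congrArg Subtype.val h2).symm
    have h4 := hg' 1
    rw [one_smul, h3] at h4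
    have h5 := (Submodule.Quotient.mk_eq_zero m).1 (hj (h4.symm.trans (map_zero j).symm))
    exact hm.ne_top ((Ideal.eq_top_iff_one m).2 h5)
  have hsub : annihilatedBy S I ⊆ injectivityDomain S (ModuleCat.of S M) := by
    intro N hN K φ
    obtain ⟨ψ, hψ⟩ := Module.Injective.extension_property S E K N K.subtype
      K.injective_subtype (M.subtype ∘ₗ φ)
    refine ⟨ψ.codRestrict M fun x a ha ↦ ?_, fun x ↦ Subtype.ext (LinearMap.congr_fun hψ x)⟩
    rw [← map_smul, hN a ha, map_zero]
  have hM : ModuleCat.of S M ∈ annihilatedBy S I := fun a ha x ↦ Subtype.ext (x.2 a ha)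
  refine ⟨ModuleCat.of S M, Set.Subset.antisymm (fun N hN a ha ↦ ?_) hsub, hM, fun h ↦ ?_⟩
  · exact key N hN a (hM a ha)
  · refine mem_annihilatedBy_quotient_iff.1 fun a ha ↦ key _ (hsub ?_) a (h a ha)
    exact mem_annihilatedBy_quotient_iff.2 le_rfl

end Injectivity

/-! ### Projectivity domains over a semiprimary ring -/

section Projectivity

variable {S : Type u} [Ring S]

/-- Reduction of endomorphisms of `F` modulo `I • F`. -/
def Module.End.quotientSMulTop (I : Ideal S) (F : Type u) [AddCommGroup F] [Module S F] :
    Module.End S F →+* Module.End S (F ⧸ I • (⊤ : Submodule S F)) where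
  toFun f := Submodule.mapQ _ _ f <| by
    rw [← Submodule.map_le_iff_le_comap, Submodule.map_smul'']
    exact Submodule.smul_mono le_rfl le_top
  map_one' := Submodule.mapQ_id _
  map_mul' f g := Submodule.mapQ_comp ..
  map_zero' := Submodule.linearMap_qext _ rfl
  map_add' f g := Submodule.linearMap_qext _ rfl

theorem Module.End.isNilpotent_of_mem_ker_quotientSMulTop {I : Ideal S} (hI : IsNilpotent I)
    {F : Type u} [AddCommGroup F] [Module S F] {f : Module.End S F}
    (hf : f ∈ RingHom.ker (Module.End.quotientSMulTop I F)) : IsNilpotent f := by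
  have hrange : ∀ x, f x ∈ I • (⊤ : Submodule S F) := fun x ↦
    (Submodule.Quotient.mk_eq_zero _).1 (LinearMap.congr_fun hf (Submodule.Quotient.mk x))
  have key : ∀ k x, (f ^ k) x ∈ (I ^ k) • (⊤ : Submodule S F) := by
    intro k
    induction k with
    | zero =>
      intro x
      rw [Submodule.pow_zero, Ideal.one_eq_top, Submodule.top_smul]
      trivial
    | succ k ih =>
      intro x
      have hmap : Submodule.map f (I ^ k • ⊤) ≤ I ^ (k + 1) • ⊤ := by
        rw [Submodule.map_smul'', Submodule.pow_succ, Submodule.mul_smul]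
        refine Submodule.smul_mono le_rfl ?_
        rintro _ ⟨y, _, rfl⟩
        exact hrange y
      rw [pow_succ']
      exact hmap ⟨_, ih x, rfl⟩
  obtain ⟨n, hn⟩ := hI
  exact ⟨n, LinearMap.ext fun x ↦ by simpa [hn] using key n x⟩

/-- If the projective module `F` maps onto `M`, the semisimple module `F ⧸ J • F` has an idempotent
endomorphism whose kernel is that of `F ⧸ J • F → M ⧸ J • M`; it lifts to an idempotent of `F`, and
the range of the lift is a projective cover of `M`. -/
theorem IsNilpotentRadical.exists_idempotent_range_cover {J : TwoSidedIdeal S}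
    (hJ : IsNilpotentRadical J) {F M : Type u} [AddCommGroup F] [Module S F] [AddCommGroup M]
    [Module S M] [Module.Projective S F] (p : F →ₗ[S] M) (hp : Function.Surjective p) :
    ∃ e : Module.End S F, (∀ x, e (e x) = e x) ∧
      Function.Surjective (p ∘ₗ (LinearMap.range e).subtype) ∧
      LinearMap.ker (p ∘ₗ (LinearMap.range e).subtype) ≤ J.asIdeal • ⊤ := by
  let JF := J.asIdeal • (⊤ : Submodule S F)
  let JM := J.asIdeal • (⊤ : Submodule S M)
  let L : Submodule S F := JM.comap p
  have hJFL : JF ≤ L := by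
    rw [← Submodule.map_le_iff_le_comap, Submodule.map_smul'']
    exact Submodule.smul_mono le_rfl le_top
  have : IsSemisimpleModule S (F ⧸ JF) :=
    (hJ.isSemisimpleModule_iff (ModuleCat.of S (F ⧸ JF))).2 fun a ha x ↦ by
      obtain ⟨y, rfl⟩ := Submodule.Quotient.mk_surjective _ (show F ⧸ JF from x)
      exact (Submodule.Quotient.mk_eq_zero JF).2
        (Submodule.smul_mem_smul (by simpa using ha) trivial)
  obtain ⟨C, hC⟩ := exists_isCompl (L.map JF.mkQ)
  let e : Module.End S (F ⧸ JF) := C.projection _ hC.symm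
  have hker : ∀ x, e (JF.mkQ x) = 0 ↔ x ∈ L := fun x ↦ by
    rw [← LinearMap.mem_ker, Submodule.ker_projection, ← Submodule.mem_comap,
      Submodule.comap_map_mkQ, sup_eq_right.2 hJFL]
  obtain ⟨e', he', hee'⟩ := exists_isIdempotentElem_eq_of_ker_isNilpotent
    (Module.End.quotientSMulTop J.asIdeal F)
    (fun _ ↦ Module.End.isNilpotent_of_mem_ker_quotientSMulTop hJ.isNilpotent) e
    (by
      obtain ⟨f, hf⟩ := Module.projective_lifting_property JF.mkQ (e ∘ₗ JF.mkQ)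
        (Submodule.mkQ_surjective _)
      exact ⟨f, Submodule.linearMap_qext _ hf⟩)
    (Submodule.isIdempotentElem_projection hC.symm)
  have hlift : ∀ x, JF.mkQ (e' x) = e (JF.mkQ x) := fun x ↦
    LinearMap.congr_fun hee' (JF.mkQ x)
  have hidem : ∀ x, e' (e' x) = e' x := fun x ↦ LinearMap.congr_fun he' x
  refine ⟨e', hidem, ?_, ?_⟩
  · rw [← LinearMap.range_eq_top]
    refine Submodule.eq_top_of_smul_sup_eq_top hJ.isNilpotent (eq_top_iff.2 fun m _ ↦ ?_)
    obtain ⟨x, rfl⟩ := hp m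
    have hx : x - e' x ∈ L := by
      rw [← hker, map_sub, map_sub, hlift, sub_eq_zero]
      exact (LinearMap.congr_fun (Submodule.isIdempotentElem_projection hC.symm) _).symm
    rw [← sub_add_cancel x (e' x), map_add]
    exact Submodule.add_mem_sup hx ⟨⟨e' x, x, rfl⟩, rfl⟩
  · rintro ⟨_, x, rfl⟩ hx
    have hL : e' x ∈ L := by
      change p (e' x) ∈ JM
      rw [show p (e' x) = 0 from hx]
      exact zero_mem _
    have h0 : e' x ∈ JF := by
      rw [← hker, ← hlift, hidem] at hL
      simpa using hL
    rw [Submodule.mem_smul_top_iff]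
    change e' x ∈ _
    rw [← hidem x, LinearMap.range_eq_map, ← Submodule.map_smul'']
    exact ⟨_, h0, rfl⟩

/-- Every module over a semiprimary ring has a projective cover. -/
theorem IsNilpotentRadical.exists_projective_cover {J : TwoSidedIdeal S}
    (hJ : IsNilpotentRadical J) (M : ModuleCat.{u} S) :
    ∃ P : ModuleCat.{u} S, Module.Projective S P ∧ ∃ π : P →ₗ[S] M,
      Function.Surjective π ∧ LinearMap.ker π ≤ J.asIdeal • ⊤ := by
  obtain ⟨e, he, hs, hk⟩ := hJ.exists_idempotent_range_cover
    (Finsupp.linearCombination S (id : M → M)) (Finsupp.linearCombination_id_surjective S M)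
  refine ⟨ModuleCat.of S (LinearMap.range e), ?_, _, hs, hk⟩
  refine Module.Projective.of_split (LinearMap.range e).subtype e.rangeRestrict
    (LinearMap.ext ?_)
  rintro ⟨_, x, rfl⟩
  exact Subtype.ext (he x)

/-- Relative projectivity in terms of a projective cover `π`: `M` is `N`-projective exactly when
every morphism to `N` from the cover factors through `π`. -/
theorem relProjective_iff_of_projective_cover {J : TwoSidedIdeal S} (hJ : IsNilpotentRadical J)
    {P M N : Type u} [AddCommGroup P] [Module S P] [AddCommGroup M] [Module S M]
    [AddCommGroup N] [Module S N] [Module.Projective S P] (π : P →ₗ[S] M)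
    (hπ : Function.Surjective π) (hker : LinearMap.ker π ≤ J.asIdeal • ⊤) :
    RelProjective S M N ↔ ∀ f : P →ₗ[S] N, LinearMap.ker π ≤ LinearMap.ker f := by
  have descend : ∀ {K : Type u} [AddCommGroup K] [Module S K] (f : P →ₗ[S] K),
      LinearMap.ker π ≤ LinearMap.ker f → ∃ ψ : M →ₗ[S] K, ψ ∘ₗ π = f := fun f hf ↦
    ⟨(LinearMap.ker π).liftQ f hf ∘ₗ (π.quotKerEquivOfSurjective hπ).symm.toLinearMap,
      LinearMap.ext fun x ↦ by
        have : (π.quotKerEquivOfSurjective hπ).symm (π x) = Submodule.Quotient.mk x := by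
          rw [LinearEquiv.symm_apply_eq]
          rfl
        simp [this]⟩
  constructor
  · intro h f
    let B := (LinearMap.ker π).map f
    obtain ⟨ψ, hψ⟩ := descend (B.mkQ ∘ₗ f) fun x hx ↦
      (Submodule.Quotient.mk_eq_zero B).2 ⟨x, hx, rfl⟩
    obtain ⟨χ, hχ⟩ := h _ B.mkQ (Submodule.mkQ_surjective _) ψ
    -- `d` agrees with `f` on the kernel of `π`, and takes no other values.
    let d : P →ₗ[S] N := f - χ ∘ₗ π
    have hd : ∀ x ∈ LinearMap.ker π, d x = f x := fun x hx ↦ by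
      simp [d, LinearMap.mem_ker.1 hx]
    have hdB : ∀ x, d x ∈ B := fun x ↦ by
      rw [← Submodule.Quotient.mk_eq_zero, ← Submodule.mkQ_apply, LinearMap.sub_apply, map_sub,
        sub_eq_zero]
      exact ((LinearMap.congr_fun hχ (π x)).trans (LinearMap.congr_fun hψ x)).symm
    have htop : LinearMap.ker d = ⊤ := by
      refine Submodule.eq_top_of_smul_sup_eq_top hJ.isNilpotent (eq_top_iff.2 fun x _ ↦ ?_)
      obtain ⟨k, hk, hkx⟩ := hdB x
      rw [← add_sub_cancel k x]
      exact Submodule.add_mem_sup (hker hk) (by simp [hd k hk, hkx])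
    intro x hx
    rw [LinearMap.mem_ker, ← hd x hx, ← LinearMap.mem_ker, htop]
    trivial
  · intro h K _ _ g hg ψ
    obtain ⟨f, hf⟩ := Module.projective_lifting_property g (ψ ∘ₗ π) hg
    obtain ⟨χ, hχ⟩ := descend f (h f)
    refine ⟨χ, LinearMap.ext fun m ↦ ?_⟩
    obtain ⟨x, rfl⟩ := hπ m
    exact (congrArg g (LinearMap.congr_fun hχ x)).trans (LinearMap.congr_fun hf x)

/-- The left ideal generated by the values on `K` of the linear forms of `P`. -/
def traceIdeal {P : Type u} [AddCommGroup P] [Module S P] (K : Submodule S P) : Ideal S :=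
  ⨆ f : P →ₗ[S] S, K.map f

instance {P : Type u} [AddCommGroup P] [Module S P] (K : Submodule S P) :
    (traceIdeal K).IsTwoSided where
  mul_mem_of_left {a} b ha := by
    have : traceIdeal K ≤ Submodule.comap (LinearMap.toSpanSingleton S S b) (traceIdeal K) :=
      iSup_le fun f ↦ by
        rw [← Submodule.map_le_iff_le_comap, ← Submodule.map_comp]
        exact le_iSup (fun f : P →ₗ[S] S ↦ K.map f) (LinearMap.toSpanSingleton S S b ∘ₗ f)
    exact this ha

/-- If `P` is a projective cover of `M` with kernel `K`, the projectivity domain of `M` consists of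
the modules annihilated by the trace ideal of `K`. -/
theorem exists_projectivityDomain_eq_annihilatedBy {J : TwoSidedIdeal S}
    (hJ : IsNilpotentRadical J) (M : ModuleCat.{u} S) :
    ∃ I ≤ J, projectivityDomain S M = annihilatedBy S I := by
  obtain ⟨P, hP, π, hπ, hker⟩ := hJ.exists_projective_cover M
  refine ⟨(traceIdeal (LinearMap.ker π)).toTwoSided, fun a ha ↦ ?_, Set.ext fun N ↦ ?_⟩
  · have hle : traceIdeal (LinearMap.ker π) ≤ J.asIdeal := iSup_le fun f ↦ by
      refine (Submodule.map_mono hker).trans ?_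
      rw [Submodule.map_smul'']
      exact (Submodule.smul_mono le_rfl le_top).trans Ideal.mul_le_left
    simpa using hle (by simpa using ha)
  · refine (relProjective_iff_of_projective_cover hJ π hπ hker).trans
      ⟨fun h a ha x ↦ ?_, fun h f k hk ↦ ?_⟩
    · have hle : traceIdeal (LinearMap.ker π) ≤
          LinearMap.ker (LinearMap.toSpanSingleton S N x) := iSup_le fun f ↦ by
        rw [Submodule.map_le_iff_le_comap]
        exact h (LinearMap.toSpanSingleton S N x ∘ₗ f)
      exact hle (by simpa using ha)
    · obtain ⟨g, hg⟩ := Module.projective_lifting_property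
        (Finsupp.linearCombination S (id : N → N)) f (Finsupp.linearCombination_id_surjective S N)
      rw [LinearMap.mem_ker, ← hg, LinearMap.comp_apply, Finsupp.linearCombination_apply]
      refine Finset.sum_eq_zero fun x _ ↦ h _ ?_ x
      rw [Ideal.mem_toTwoSided]
      exact Submodule.mem_iSup_of_mem (Finsupp.lapply x ∘ₗ g) ⟨k, hk, rfl⟩

theorem exists_projectivityDomain_eq {J : TwoSidedIdeal S} (hJ : IsNilpotentRadical J)
    {I : TwoSidedIdeal S} (hI : I ≤ J) :
    ∃ M : ModuleCat.{u} S, projectivityDomain S M = annihilatedBy S I ∧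
      M ∈ annihilatedBy S I ∧ (M ∈ annihilatedBy S J → J ≤ I) := by
  refine ⟨ModuleCat.of S (S ⧸ I.asIdeal), Set.ext fun N ↦ ?_,
    mem_annihilatedBy_quotient_iff.2 le_rfl, mem_annihilatedBy_quotient_iff.1⟩
  refine (relProjective_iff_of_projective_cover hJ I.asIdeal.mkQ (Submodule.mkQ_surjective _)
    ?_).trans ⟨fun h a ha x ↦ ?_, fun h f a ha ↦ ?_⟩
  · rw [Submodule.ker_mkQ]
    intro a ha
    rw [← mul_one a]
    exact Submodule.smul_mem_smul (TwoSidedIdeal.asIdeal.monotone hI ha) trivial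
  · exact h (LinearMap.toSpanSingleton S N x) (by simpa using ha)
  · rw [Submodule.ker_mkQ] at ha
    have := h a (by simpa using ha) (f 1)
    rwa [← map_smul, smul_eq_mul, mul_one] at this

theorem projectivityDomain_eq_univ_iff (M : ModuleCat.{u} S) :
    projectivityDomain S M = Set.univ ↔ Module.Projective S M := by
  constructor
  · intro h
    refine Module.Projective.of_lifting_property'' fun f hf ↦ ?_
    have hF : ModuleCat.of S (M →₀ S) ∈ projectivityDomain S M := h ▸ trivial
    exact hF M f hf LinearMap.id
  · intro h
    exact Set.eq_univ_of_forall fun N K _ _ g hg ψ ↦ Module.projective_lifting_property g ψ hg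

end Projectivity

/-! ### Domains classified by the ideals in the radical -/

section Profile

variable {S : Type u} [Ring S]

/-- The assignment `D` of a domain to each module is governed by the two-sided ideals contained in
`J`: the domains are exactly the classes annihilated by such an ideal, and each of these is the
domain of one of its members, which can be chosen not to be annihilated by `J` unless the ideal
is `J` itself. -/
structure IsClassifiedBy (D : ModuleCat.{u} S → Set (ModuleCat.{u} S)) (J : TwoSidedIdeal S) :
    Prop where
  exists_eq : ∀ M, ∃ I ≤ J, D M = annihilatedBy S I
  exists_module : ∀ I ≤ J, ∃ M, D M = annihilatedBy S I ∧
    M ∈ annihilatedBy S I ∧ (M ∈ annihilatedBy S J → J ≤ I)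

theorem isClassifiedBy_injectivityDomain [IsArtinianRing S] {J : TwoSidedIdeal S}
    (hJ : IsNilpotentRadical J) : IsClassifiedBy (injectivityDomain S) J :=
  ⟨exists_injectivityDomain_eq_annihilatedBy hJ, fun _ ↦ exists_injectivityDomain_eq hJ⟩

theorem isClassifiedBy_projectivityDomain {J : TwoSidedIdeal S}
    (hJ : IsNilpotentRadical J) : IsClassifiedBy (projectivityDomain S) J :=
  ⟨exists_projectivityDomain_eq_annihilatedBy hJ, fun _ ↦ exists_projectivityDomain_eq hJ⟩

variable {D : ModuleCat.{u} S → Set (ModuleCat.{u} S)} {J : TwoSidedIdeal S}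

/-- The ideals contained in `J`, ordered by reverse inclusion, correspond to the domains. -/
noncomputable def IsClassifiedBy.orderIso (hD : IsClassifiedBy D J) :
    (Set.Iic J)ᵒᵈ ≃o {A | ∃ M, A = D M} :=
  RelIso.ofSurjective
    (OrderEmbedding.ofMapLEIff (α := (Set.Iic J)ᵒᵈ) (β := {A | ∃ M, A = D M})
      (fun I ↦ ⟨annihilatedBy S (OrderDual.ofDual I).1,
        (hD.exists_module _ (OrderDual.ofDual I).2).imp fun _ h ↦ h.1.symm⟩)
      fun _ _ ↦ annihilatedBy_subset_iff)
    (by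
      rintro ⟨_, M, rfl⟩
      obtain ⟨I, hI, h⟩ := hD.exists_eq M
      exact ⟨OrderDual.toDual ⟨I, hI⟩, Subtype.ext h.symm⟩)

/-- There is no domain strictly between the class of semisimple modules and the class of all
modules if and only if there is no ideal strictly between `⊥` and `J`. -/
theorem IsClassifiedBy.forall_eq_univ_or_subset_iff (hD : IsClassifiedBy D J) :
    (∀ M, D M = Set.univ ∨ D M ⊆ annihilatedBy S J) ↔ ∀ I ≤ J, I = ⊥ ∨ I = J := by
  constructor
  · intro h I hI
    obtain ⟨M, hM, -⟩ := hD.exists_module I hI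
    have := h M
    rw [hM, annihilatedBy_eq_univ_iff, annihilatedBy_subset_iff] at this
    exact this.imp_right hI.antisymm
  · intro h M
    obtain ⟨I, hI, hM⟩ := hD.exists_eq M
    rw [hM, annihilatedBy_eq_univ_iff, annihilatedBy_subset_iff]
    exact (h I hI).imp_right ge_of_eq

/-- Stated for the injectivity or projectivity domain: every non-semisimple module that is injective
or projective relative to itself is injective or projective. For an ideal `I ≠ J`, the module chosen
to have the domain annihilated by `I` belongs to this domain and is not semisimple. -/
theorem IsClassifiedBy.forall_self_mem_iff (hD : IsClassifiedBy D J) :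
    (∀ M, M ∉ annihilatedBy S J → M ∈ D M → D M = Set.univ) ↔ ∀ I ≤ J, I = ⊥ ∨ I = J := by
  constructor
  · intro h I hI
    obtain ⟨M, hM, hMI, hMJ⟩ := hD.exists_module I hI
    by_cases hss : M ∈ annihilatedBy S J
    · exact Or.inr (hI.antisymm (hMJ hss))
    · have := h M hss (hM ▸ hMI)
      rw [hM, annihilatedBy_eq_univ_iff] at this
      exact Or.inl this
  · intro h M hM hself
    exact (hD.forall_eq_univ_or_subset_iff.2 h M).resolve_right fun hsub ↦ hM (hsub hself)

theorem IsNilpotentRadical.setOf_isSemisimpleModule (hJ : IsNilpotentRadical J) :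
    {N : ModuleCat.{u} S | IsSemisimpleModule S N} = annihilatedBy S J :=
  Set.ext hJ.isSemisimpleModule_iff

theorem hasNoIMiddleClass_iff [IsArtinianRing S] (hJ : IsNilpotentRadical J) :
    HasNoIMiddleClass S ↔ ∀ I ≤ J, I = ⊥ ∨ I = J := by
  rw [← (isClassifiedBy_injectivityDomain hJ).forall_eq_univ_or_subset_iff]
  refine forall_congr' fun M ↦ or_congr (injectivityDomain_eq_univ_iff M).symm ?_
  rw [IsPoorModule, hJ.setOf_isSemisimpleModule]
  refine ⟨fun h ↦ h.subset, fun h ↦ h.antisymm fun N hN ↦ ?_⟩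
  have := (hJ.isSemisimpleModule_iff N).2 hN
  exact RelInjective.of_isSemisimpleModule

theorem quasiInjectiveImpInjective_iff [IsArtinianRing S] (hJ : IsNilpotentRadical J) :
    QuasiInjectiveImpInjective S ↔ ∀ I ≤ J, I = ⊥ ∨ I = J := by
  rw [← (isClassifiedBy_injectivityDomain hJ).forall_self_mem_iff]
  refine forall_congr' fun M ↦ ?_
  rw [hJ.isSemisimpleModule_iff, injectivityDomain_eq_univ_iff]
  rfl

theorem hasNoPMiddleClass_iff (hJ : IsNilpotentRadical J) :
    HasNoPMiddleClass S ↔ ∀ I ≤ J, I = ⊥ ∨ I = J := by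
  rw [← (isClassifiedBy_projectivityDomain hJ).forall_eq_univ_or_subset_iff]
  refine forall_congr' fun M ↦ or_congr (projectivityDomain_eq_univ_iff M).symm ?_
  rw [IsPPoorModule, hJ.setOf_isSemisimpleModule]

theorem quasiProjectiveImpProjective_iff (hJ : IsNilpotentRadical J) :
    QuasiProjectiveImpProjective S ↔ ∀ I ≤ J, I = ⊥ ∨ I = J := by
  rw [← (isClassifiedBy_projectivityDomain hJ).forall_self_mem_iff]
  refine forall_congr' fun M ↦ ?_
  rw [hJ.isSemisimpleModule_iff, projectivityDomain_eq_univ_iff]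
  rfl

end Profile

/-! ### Comparison with the opposite ring -/

section Conclusion

theorem IsLatticeOrder.of_orderIso {α β : Type*} [Lattice α] [PartialOrder β] (e : α ≃o β) :
    IsLatticeOrder β := by
  intro a b
  have himage : ({a, b} : Set β) = e '' {e.symm a, e.symm b} := by
    simp [Set.image_pair]
  rw [himage]
  exact ⟨⟨_, e.isLUB_image'.2 isLUB_pair⟩, ⟨_, e.isGLB_image'.2 isGLB_pair⟩⟩

theorem TwoSidedIdeal.le_unop_iff {R : Type u} [Ring R] {I : TwoSidedIdeal R}
    {J : TwoSidedIdeal Rᵐᵒᵖ} : I ≤ J.unop ↔ I.op ≤ J :=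
  (TwoSidedIdeal.opOrderIso (R := R)).le_symm_apply

theorem TwoSidedIdeal.forall_le_unop_iff {R : Type u} [Ring R] (J : TwoSidedIdeal Rᵐᵒᵖ) :
    (∀ I ≤ J.unop, I = ⊥ ∨ I = J.unop) ↔ ∀ I ≤ J, I = ⊥ ∨ I = J := by
  refine TwoSidedIdeal.opOrderIso.toEquiv.forall_congr fun {I} ↦
    imp_congr TwoSidedIdeal.le_unop_iff (or_congr ?_ ?_)
  · exact (map_eq_bot_iff TwoSidedIdeal.opOrderIso).symm
  · exact (OrderIso.eq_symm_apply TwoSidedIdeal.opOrderIso)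

theorem corollary4p7 (R : Type u) [Ring R] (hR : IsArtinianRing Rᵐᵒᵖ) :
    (IsLatticeOrder (iProfile Rᵐᵒᵖ) ∧ IsLatticeOrder (pProfile Rᵐᵒᵖ) ∧
      IsLatticeOrder (pProfile R)) ∧
    (Nonempty (iProfile Rᵐᵒᵖ ≃o pProfile Rᵐᵒᵖ) ∧
      Nonempty (iProfile Rᵐᵒᵖ ≃o pProfile R) ∧
      Nonempty (pProfile Rᵐᵒᵖ ≃o pProfile R)) ∧
    List.TFAE [
      HasNoIMiddleClass Rᵐᵒᵖ,
      QuasiInjectiveImpInjective Rᵐᵒᵖ,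
      HasNoPMiddleClass Rᵐᵒᵖ,
      QuasiProjectiveImpProjective Rᵐᵒᵖ,
      HasNoPMiddleClass R,
      QuasiProjectiveImpProjective R] := by
  have hJ := IsNilpotentRadical.of_isArtinianRing (S := Rᵐᵒᵖ)
  generalize (Ring.jacobson Rᵐᵒᵖ).toTwoSided = J at hJ
  let ei : (Set.Iic J)ᵒᵈ ≃o iProfile Rᵐᵒᵖ := (isClassifiedBy_injectivityDomain hJ).orderIso
  let ep : (Set.Iic J)ᵒᵈ ≃o pProfile Rᵐᵒᵖ := (isClassifiedBy_projectivityDomain hJ).orderIso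
  let eℓ : (Set.Iic J)ᵒᵈ ≃o pProfile R := (TwoSidedIdeal.opOrderIso.symm.Iic J).dual.trans
    (isClassifiedBy_projectivityDomain hJ.unop).orderIso
  refine ⟨⟨.of_orderIso ei, .of_orderIso ep, .of_orderIso eℓ⟩,
    ⟨⟨ei.symm.trans ep⟩, ⟨ei.symm.trans eℓ⟩, ⟨ep.symm.trans eℓ⟩⟩, ?_⟩
  refine List.tfae_of_forall (∀ I ≤ J, I = ⊥ ∨ I = J) _ ?_
  simp only [List.forall_mem_cons]
  exact ⟨hasNoIMiddleClass_iff hJ, quasiInjectiveImpInjective_iff hJ, hasNoPMiddleClass_iff hJ,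
    quasiProjectiveImpProjective_iff hJ,
    (hasNoPMiddleClass_iff hJ.unop).trans (TwoSidedIdeal.forall_le_unop_iff J),
    (quasiProjectiveImpProjective_iff hJ.unop).trans (TwoSidedIdeal.forall_le_unop_iff J),
    fun _ h ↦ absurd h List.not_mem_nil⟩

end Conclusion
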